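/- Let $F$ and $G$ be cusp forms of even weights $k$ and $l$ for $SL_2(\mathbb Z)$, with Fourier expansions $F(\tau)=\sum_{n\ge1}a_ne^{2\pi in\tau}$ and $G(\tau)=\sum_{n\ge1}b_ne^{2\pi in\tau}$. Let $\mathbb A^\times$ be the group of ideles of $\mathbb Q$; write $x=(x_f,x_\infty)$ for an idele with finite part $x_f$ and real component $x_\infty\in\mathbb R^\times$, and put $|x|=|x_\infty|_\infty\prod_p|x_p|_p$, where $|p|_p=1/p$. Let $d^\times x$ be the product of the measure $dx_\infty/|x_\infty|_\infty$ on $\mathbb R^\times$ ($dx_\infty$ being Lebesgue measure) and of the Haar measures $d_p^\times x_p$ on $\mathbb Q_p^\times$ that give $\mathbb Z_p^\times$ the mass $1$. With $\hat{\mathbb Z}^\times=\prod_p\mathbb Z_p^\times$, let $f_f(x_f)=a_n$ and $g_f(x_f)=b_n$ if $x_f\in n\hat{\mathbb Z}^\times$ for an integer $n\ge1$, and $f_f(x_f)=g_f(x_f)=0$ if there is no such $n$; and let $$f(x)=f_f(x_f)\,e^{-2\pi|x_\infty|_\infty},\qquad g(x)=g_f(x_f)\,e^{-2\pi|x_\infty|_\infty}.$$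 For $s_1,s_2\in\mathbb C$ put $$J(s_1,s_2)=\int_{|x_1|>|x_2|}f(x_1)|x_1|^{s_1}d^\times x_1\;g(x_2)|x_2|^{s_2}d^\times x_2,$$ an integral over pairs of ideles, and $$\Lambda(F,G,s_1,s_2)=\int_{t_1>t_2>0}F(it_1)\,t_1^{s_1}\,G(it_2)\,t_2^{s_2}\,\frac{dt_1}{t_1}\frac{dt_2}{t_2}.$$ **Theorem 6.1.** The integral $\Lambda(F,G,s_1,s_2)$ converges absolutely for all $s_1,s_2\in\mathbb C$. The integral $J(s_1,s_2)$ converges absolutely whenever $\operatorname{Re}s_1>\frac k2+1$ and $\operatorname{Re}s_2>\frac l2+1$. For all $s_1,s_2$ at which $J(s_1,s_2)$ converges absolutely, $$J(s_1,s_2)=4\,\Lambda(F,G,s_1,s_2).$$ -/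

import Mathlib

open NumberField IsDedekindDomain MeasureTheory UpperHalfPlane
open scoped NumberField.AdeleRing MatrixGroups

noncomputable section

namespace IdelicIteratedIntegral

/-- The ring `𝔸_f` of finite adeles of `ℚ`. -/
abbrev FinAdele : Type := FiniteAdeleRing (𝓞 ℚ) ℚ

/-- The ring `𝔸` of adeles of `ℚ`. -/
abbrev Adele : Type := AdeleRing (𝓞 ℚ) ℚ

instance : T2Space FinAdele :=
  inferInstanceAs <| T2Space <| RestrictedProduct
    (fun v : HeightOneSpectrum (𝓞 ℚ) => v.adicCompletion ℚ)
    (fun v => (v.adicCompletionIntegers ℚ : Set (v.adicCompletion ℚ))) Filter.cofinite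

instance : MeasurableSpace FinAdeleˣ := borel _
instance : BorelSpace FinAdeleˣ := ⟨rfl⟩
instance : MeasurableSpace Adeleˣ := borel _
instance : BorelSpace Adeleˣ := ⟨rfl⟩

/-! ### The group of finite ideles -/

/-- The norm `|x_f|_f = ∏_p |x_p|_p` of a finite idele, with `|p|_p = 1 / p`. -/
def finNorm (x : FinAdeleˣ) : ℝ :=
  ∏ᶠ v : HeightOneSpectrum (𝓞 ℚ), ‖(x : FinAdele) v‖

/-- The subring `Ẑ = ∏_p ℤ_p` of the finite adeles, as a set. -/
def zHat : Set FinAdele :=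
  {x | ∀ v : HeightOneSpectrum (𝓞 ℚ), x v ∈ v.adicCompletionIntegers ℚ}

/-- The group `Ẑˣ = ∏_p ℤ_pˣ`, as a subset of the finite ideles. -/
def zHatUnits : Set FinAdeleˣ :=
  {x | (x : FinAdele) ∈ zHat ∧ ((x⁻¹ : FinAdeleˣ) : FinAdele) ∈ zHat}

lemma isOpen_zHat : IsOpen zHat :=
  RestrictedProduct.isOpen_forall_mem
    (R := fun v : HeightOneSpectrum (𝓞 ℚ) => v.adicCompletion ℚ)
    (A := fun v => (v.adicCompletionIntegers ℚ : Set (v.adicCompletion ℚ)))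
    (fun _ => Valued.isOpen_valuationSubring _)

lemma isCompact_zHat : IsCompact zHat := by
  have (v : HeightOneSpectrum (𝓞 ℚ)) :
      CompactSpace (v.adicCompletionIntegers ℚ : Set (v.adicCompletion ℚ)) := by
    have : Fact (Rat.HeightOneSpectrum.primesEquiv v).1.Prime :=
      ⟨(Rat.HeightOneSpectrum.primesEquiv v).2⟩
    exact (Rat.HeightOneSpectrum.adicCompletionIntegers.padicIntEquiv
      v).toHomeomorph.symm.compactSpace
  have h := isCompact_range (RestrictedProduct.isEmbedding_structureMap
    (R := fun v : HeightOneSpectrum (𝓞 ℚ) => v.adicCompletion ℚ)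
    (A := fun v => (v.adicCompletionIntegers ℚ : Set (v.adicCompletion ℚ)))
    (𝓕 := Filter.cofinite)).continuous
  rw [RestrictedProduct.range_structureMap] at h
  exact h

lemma isOpen_zHatUnits : IsOpen zHatUnits :=
  (isOpen_zHat.preimage Units.continuous_val).inter
    (isOpen_zHat.preimage (Units.continuous_val.comp continuous_inv))

lemma isCompact_zHatUnits : IsCompact zHatUnits := by
  have hcl : Topology.IsClosedEmbedding (Units.embedProduct FinAdele) := by
    refine ⟨Units.isEmbedding_embedProduct, ?_⟩
    have : Set.range (Units.embedProduct FinAdele) =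
        {p : FinAdele × FinAdeleᵐᵒᵖ | p.1 * p.2.unop = 1} := by
      ext p
      constructor
      · rintro ⟨u, rfl⟩
        simp [Units.embedProduct]
      · intro hp
        exact ⟨⟨p.1, p.2.unop, hp, by rw [mul_comm]; exact hp⟩, rfl⟩
    rw [this]
    exact isClosed_eq
      (continuous_fst.mul (MulOpposite.continuous_unop.comp continuous_snd)) continuous_const
  have hK : IsCompact (zHat ×ˢ (MulOpposite.unop ⁻¹' zHat : Set FinAdeleᵐᵒᵖ)) :=
    isCompact_zHat.prod
      (MulOpposite.opHomeomorph.symm.isCompact_preimage.mpr isCompact_zHat)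
  exact hcl.isCompact_preimage hK

/-- `Ẑˣ` as a compact set with non-empty interior. -/
def zHatUnitsCompacts : TopologicalSpace.PositiveCompacts FinAdeleˣ where
  carrier := zHatUnits
  isCompact' := isCompact_zHatUnits
  interior_nonempty' := by
    rw [isOpen_zHatUnits.interior_eq]
    exact ⟨1, fun v => one_mem (v.adicCompletionIntegers ℚ),
      fun v => one_mem (v.adicCompletionIntegers ℚ)⟩

/-- The measure `d_fˣ x_f = ∏_p d_pˣ x_p` on the finite ideles, where `d_pˣ x_p` gives `ℤ_pˣ`
the mass one: it is the Haar measure that gives `Ẑˣ = ∏_p ℤ_pˣ` the mass one. -/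
def finMeasure : Measure FinAdeleˣ :=
  Measure.haarMeasure zHatUnitsCompacts

/-- The set `n Ẑˣ` inside the finite ideles (empty for `n = 0`). -/
def natMulZHatUnits (n : ℕ) : Set FinAdeleˣ :=
  {x | ∃ u ∈ zHatUnits, (x : FinAdele) = (n : FinAdele) * (u : FinAdele)}

open Classical in
/-- The function on the finite ideles that is `a n` on `n Ẑˣ` for `n = 1, 2, 3, …`, and `0` off
the union of these (pairwise disjoint) sets. -/
def finFun (a : ℕ → ℂ) (x : FinAdeleˣ) : ℂ :=
  if h : ∃ n : ℕ, x ∈ natMulZHatUnits n then a h.choose else 0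

/-! ### The group of ideles -/

/-- The real numbers as the archimedean part of the adeles of `ℚ`. -/
def realEquiv : ℝ ≃+* InfiniteAdeleRing ℚ where
  toFun r := fun v => (InfinitePlace.Completion.ringEquivRealOfIsReal
    (IsTotallyReal.isReal v)).symm r
  invFun x := InfinitePlace.Completion.ringEquivRealOfIsReal
    (IsTotallyReal.isReal default) (x default)
  left_inv r := by simp
  right_inv x := by
    funext v
    obtain rfl := Subsingleton.elim v default
    exact RingEquiv.symm_apply_apply _ _
  map_mul' r s := by funext v; exact map_mul _ r s
  map_add' r s := by funext v; exact map_add _ r s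

lemma continuous_realEquiv : Continuous realEquiv :=
  continuous_pi fun v => (InfinitePlace.Completion.isometryEquivRealOfIsReal
    (IsTotallyReal.isReal v)).symm.continuous

lemma continuous_realEquiv_symm : Continuous realEquiv.symm :=
  (InfinitePlace.Completion.isometryEquivRealOfIsReal
    (IsTotallyReal.isReal default)).continuous.comp (continuous_apply _)

/-- The isomorphism `(x_∞, x_f) ↦ x` of topological groups from `ℝˣ × 𝔸_fˣ` to the ideles. -/
def ideleEquiv : ℝˣ × FinAdeleˣ ≃ₜ* Adeleˣ where
  toMulEquiv := ((Units.mapEquiv realEquiv.toMulEquiv).prodCongr (MulEquiv.refl FinAdeleˣ)).trans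
    (MulEquiv.prodUnits (M := InfiniteAdeleRing ℚ) (N := FinAdele)).symm
  continuous_toFun := (Homeomorph.prodUnits (α := InfiniteAdeleRing ℚ)
      (β := FinAdele)).symm.continuous.comp
    ((Continuous.units_map realEquiv.toMulEquiv.toMonoidHom continuous_realEquiv).prodMap
      continuous_id)
  continuous_invFun := ((Continuous.units_map realEquiv.symm.toMulEquiv.toMonoidHom
      continuous_realEquiv_symm).prodMap continuous_id).comp
    (Homeomorph.prodUnits (α := InfiniteAdeleRing ℚ) (β := FinAdele)).continuous

/-- The real component `x_∞` of an idele. -/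
def infPart (x : Adeleˣ) : ℝˣ := (ideleEquiv.symm x).1

/-- The finite component `x_f` of an idele. -/
def finPart (x : Adeleˣ) : FinAdeleˣ := (ideleEquiv.symm x).2

/-- The norm `|x| = |x_∞|_∞ ∏_p |x_p|_p` of an idele. -/
def ideleNorm (x : Adeleˣ) : ℝ := |(infPart x : ℝ)| * finNorm (finPart x)

/-- The measure `dx / |x|` on `ℝˣ`, with `dx` the Lebesgue measure. -/
def realMeasure : Measure ℝˣ :=
  (volume.withDensity fun x : ℝ => ENNReal.ofReal |x|⁻¹).comap Units.val

instance : BorelSpace ℝˣ :=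
  ⟨by
    rw [Units.isEmbedding_val₀.eq_induced, borel_comap]
    exact congrArg _ BorelSpace.measurable_eq⟩

instance : SecondCountableTopology ℝˣ :=
  Units.isEmbedding_val₀.secondCountableTopology

lemma measurableEmbedding_ideleEquiv : MeasurableEmbedding ideleEquiv :=
  ideleEquiv.toHomeomorph.measurableEmbedding

/-- The measure `dˣ x` on the ideles: the product of `dx / |x|` on `ℝˣ` and of `d_fˣ x_f`. -/
def ideleMeasure : Measure Adeleˣ := (realMeasure.prod finMeasure).map ideleEquiv

/-- The function `f(x) = f_f(x_f) e^{-2π |x_∞|}` on the ideles, where `f_f` is `a n` on `n Ẑˣ`. -/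
def ideleFun (a : ℕ → ℂ) (x : Adeleˣ) : ℂ :=
  finFun a (finPart x) * (Real.exp (-2 * Real.pi * |(infPart x : ℝ)|) : ℂ)

/-! ### The two iterated integrals -/

/-- The domain `|x₁| > |x₂|` in the pairs of ideles. -/
def ideleDomain : Set (Adeleˣ × Adeleˣ) := {x | ideleNorm x.2 < ideleNorm x.1}

/-- The integrand `f(x₁) |x₁|^s₁ g(x₂) |x₂|^s₂`, where `f` and `g` belong to the sequences
`a` and `b`. -/
def ideleIntegrand (a b : ℕ → ℂ) (s₁ s₂ : ℂ) (x : Adeleˣ × Adeleˣ) : ℂ :=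
  ideleFun a x.1 * (ideleNorm x.1 : ℂ) ^ s₁ * (ideleFun b x.2 * (ideleNorm x.2 : ℂ) ^ s₂)

/-- Absolute convergence of the integral `J`. -/
def JConverges (a b : ℕ → ℂ) (s₁ s₂ : ℂ) : Prop :=
  IntegrableOn (ideleIntegrand a b s₁ s₂) ideleDomain (ideleMeasure.prod ideleMeasure)

/-- `J(s₁, s₂) = ∫_{|x₁| > |x₂|} f(x₁) |x₁|^s₁ dˣx₁ g(x₂) |x₂|^s₂ dˣx₂`. -/
def J (a b : ℕ → ℂ) (s₁ s₂ : ℂ) : ℂ :=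
  ∫ x in ideleDomain, ideleIntegrand a b s₁ s₂ x ∂(ideleMeasure.prod ideleMeasure)

/-- The domain `t₁ > t₂ > 0`. -/
def realDomain : Set (ℝ × ℝ) := {t | t.2 < t.1 ∧ 0 < t.2}

/-- The integrand `F(i t₁) t₁^s₁ G(i t₂) t₂^s₂ / (t₁ t₂)`. -/
def realIntegrand (F G : ℍ → ℂ) (s₁ s₂ : ℂ) (t : ℝ × ℝ) : ℂ :=
  F (ofComplex (Complex.I * t.1)) * (t.1 : ℂ) ^ s₁ *
    (G (ofComplex (Complex.I * t.2)) * (t.2 : ℂ) ^ s₂) / (t.1 * t.2)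

/-- Absolute convergence of the integral `Λ`. -/
def LambdaConverges (F G : ℍ → ℂ) (s₁ s₂ : ℂ) : Prop :=
  IntegrableOn (realIntegrand F G s₁ s₂) realDomain

/-- `Λ(F, G, s₁, s₂) = ∫_{t₁ > t₂ > 0} F(i t₁) t₁^s₁ G(i t₂) t₂^s₂ dt₁/t₁ dt₂/t₂`. -/
def Lambda (F G : ℍ → ℂ) (s₁ s₂ : ℂ) : ℂ :=
  ∫ t in realDomain, realIntegrand F G s₁ s₂ t

/-- The Fourier coefficients `a n` of `F(τ) = ∑ a n e^{2π i n τ}`. -/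
def fourierCoeff (F : ℍ → ℂ) (n : ℕ) : ℂ := (qExpansion 1 F).coeff n

end IdelicIteratedIntegral

end

noncomputable section

namespace IdelicIteratedIntegral

open scoped Pointwise

/-! ### Finite ideles -/

/-! If the finite part of an idele $x$ lies in $n\hat{\mathbb Z}^\times$, then its finite norm is
$1/n$, so $|x_\infty| = n|x|$. Hence $f(x)|x|^s = a_n e^{-2\pi n t}t^s$ with $t = |x|$: the
integrand depends only on the pair $(n, t)$, and the domain only on the norms.

On the ideles that have such an $n$, the map $x \mapsto (n, t)$ carries $d^\times x$ to counting
measure times $2\,dt/t$ (`measurePreserving_indexNorm`). Each coset $n\hat{\mathbb Z}^\times$ has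
mass one, $dx/|x|$ is invariant under scaling, and the two signs of $x_\infty$ give the 2. Summing
over both indices by Fubini turns the $q$-expansions into $F(it_1)$ and $G(it_2)$, and $2\cdot2$ is
the constant 4 (`setIntegral_indexIntegrand`, `integral_absMeasure_prod`).

$\Lambda$ converges because the Mellin integrals of cusp forms do, over the whole quadrant. $J$
converges in the stated range by Hecke's bound $a_n = O(n^{k/2})$ and a Gamma integral
(`integrable_coeffTerm`). -/

lemma coe_mul_apply (x y : FinAdeleˣ) (v : HeightOneSpectrum (𝓞 ℚ)) :
    ((x * y : FinAdeleˣ) : FinAdele) v = (x : FinAdele) v * (y : FinAdele) v := rfl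

lemma coe_ne_zero (x : FinAdeleˣ) (v : HeightOneSpectrum (𝓞 ℚ)) : (x : FinAdele) v ≠ 0 :=
  (FiniteAdeleRing.isUnit_iff.mp x.isUnit).1 v

lemma eventually_valued_eq_one (x : FinAdeleˣ) :
    ∀ᶠ v : HeightOneSpectrum (𝓞 ℚ) in Filter.cofinite, Valued.v ((x : FinAdele) v) = 1 :=
  (FiniteAdeleRing.isUnit_iff.mp x.isUnit).2

lemma coe_inv_apply (x : FinAdeleˣ) (v : HeightOneSpectrum (𝓞 ℚ)) :
    ((x⁻¹ : FinAdeleˣ) : FinAdele) v = ((x : FinAdele) v)⁻¹ := by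
  refine eq_inv_of_mul_eq_one_left ?_
  rw [← coe_mul_apply, inv_mul_cancel]
  rfl

lemma mem_zHatUnits_iff (x : FinAdeleˣ) :
    x ∈ zHatUnits ↔ ∀ v, Valued.v ((x : FinAdele) v) = 1 := by
  have h (v : HeightOneSpectrum (𝓞 ℚ)) : Valued.v ((x : FinAdele) v) ≠ 0 := by
    simpa using coe_ne_zero x v
  simp only [zHatUnits, zHat, Set.mem_ofPred_eq, HeightOneSpectrum.mem_adicCompletionIntegers,
    coe_inv_apply, map_inv₀, ← forall_and]
  refine forall_congr' fun v ↦ ⟨fun ⟨h₁, h₂⟩ ↦ le_antisymm h₁ ?_, fun h₁ ↦ by simp [h₁]⟩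
  exact (inv_le_one₀ (zero_lt_iff.mpr (h v))).mp h₂

lemma norm_eq_one_of_mem_zHatUnits {x : FinAdeleˣ} (hx : x ∈ zHatUnits)
    (v : HeightOneSpectrum (𝓞 ℚ)) : ‖(x : FinAdele) v‖ = 1 := by
  rw [FinitePlace.norm_def, (mem_zHatUnits_iff x).mp hx v, map_one, NNReal.coe_one]

lemma finNorm_mul_of_mem_zHatUnits (x : FinAdeleˣ) {u : FinAdeleˣ} (hu : u ∈ zHatUnits) :
    finNorm (x * u) = finNorm x := by
  refine finprod_congr fun v ↦ ?_
  rw [coe_mul_apply, norm_mul, norm_eq_one_of_mem_zHatUnits hu, mul_one]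

lemma mem_smul_zHatUnits_iff (x y : FinAdeleˣ) :
    y ∈ x • zHatUnits ↔ ∀ v, Valued.v ((y : FinAdele) v) = Valued.v ((x : FinAdele) v) := by
  rw [Set.mem_smul_set_iff_inv_smul_mem, smul_eq_mul, mem_zHatUnits_iff]
  refine forall_congr' fun v ↦ ?_
  have h : Valued.v ((x : FinAdele) v) ≠ 0 := by simpa using coe_ne_zero x v
  rw [coe_mul_apply, coe_inv_apply, map_mul, map_inv₀, inv_mul_eq_one₀ h, eq_comm]

lemma isOpen_smul_zHatUnits (x : FinAdeleˣ) : IsOpen (x • zHatUnits) :=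
  isOpen_zHatUnits.smul x

lemma one_mem_zHatUnits : (1 : FinAdeleˣ) ∈ zHatUnits :=
  (mem_zHatUnits_iff 1).mpr fun _ ↦ map_one _

lemma mem_smul_zHatUnits_self (x : FinAdeleˣ) : x ∈ x • zHatUnits :=
  ⟨1, one_mem_zHatUnits, mul_one x⟩

lemma continuous_finNorm : Continuous finNorm := by
  refine IsLocallyConstant.continuous ((IsLocallyConstant.iff_exists_open _).mpr fun x ↦
    ⟨x • zHatUnits, isOpen_smul_zHatUnits x, mem_smul_zHatUnits_self x, ?_⟩)
  rintro _ ⟨u, hu, rfl⟩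
  exact finNorm_mul_of_mem_zHatUnits x hu

instance : finMeasure.IsHaarMeasure := Measure.isHaarMeasure_haarMeasure _

lemma finMeasure_smul_zHatUnits (x : FinAdeleˣ) : finMeasure (x • zHatUnits) = 1 := by
  rw [measure_smul]
  exact Measure.haarMeasure_self (K₀ := zHatUnitsCompacts)

instance : Countable (HeightOneSpectrum (𝓞 ℚ)) :=
  Rat.HeightOneSpectrum.primesEquiv.injective.countable

/-- The exponents of the primes in a finite idele. -/
def finOrder (x : FinAdeleˣ) : HeightOneSpectrum (𝓞 ℚ) →₀ ℤ :=
  Finsupp.ofSupportFinite (fun v ↦ (Valued.v ((x : FinAdele) v)).log) <| by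
    refine (Filter.eventually_cofinite.mp (eventually_valued_eq_one x)).subset fun v hv h ↦ hv ?_
    simp [h]

lemma mem_smul_zHatUnits_of_finOrder_eq {x y : FinAdeleˣ} (h : finOrder y = finOrder x) :
    y ∈ x • zHatUnits :=
  (mem_smul_zHatUnits_iff x y).mpr fun v ↦ by
    have hx : Valued.v ((x : FinAdele) v) ≠ 0 := by simpa using coe_ne_zero x v
    have hy : Valued.v ((y : FinAdele) v) ≠ 0 := by simpa using coe_ne_zero y v
    have hv : (Valued.v ((y : FinAdele) v)).log = (Valued.v ((x : FinAdele) v)).log :=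
      DFunLike.congr_fun h v
    rw [← WithZero.exp_log hx, ← WithZero.exp_log hy, hv]

/-- The prime exponents are finitely supported integer functions on a countable set, so there are
countably many fibres, each inside a coset of mass one. -/
instance : SigmaFinite finMeasure := by
  refine Measure.sigmaFinite_of_countable (S := Set.range fun d ↦ finOrder ⁻¹' {d})
    (Set.countable_range _) ?_ ?_
  · rintro _ ⟨d, rfl⟩
    rcases (finOrder ⁻¹' {d}).eq_empty_or_nonempty with h | ⟨x, rfl⟩
    · simp [h]
    · refine (measure_mono fun y hy ↦ mem_smul_zHatUnits_of_finOrder_eq hy).trans_lt ?_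
      rw [finMeasure_smul_zHatUnits]
      exact ENNReal.one_lt_top
  · exact Set.eq_univ_of_forall fun x ↦ ⟨_, ⟨finOrder x, rfl⟩, rfl⟩

/-! ### The positive integers among the finite ideles -/

/-- The diagonal finite idele of a positive integer. -/
def natIdele (n : ℕ) [NeZero n] : FinAdeleˣ :=
  FiniteAdeleRing.unitEmbedding (𝓞 ℚ) ℚ (Units.mk0 (n : ℚ) (NeZero.ne _))

lemma coe_natIdele (n : ℕ) [NeZero n] : (natIdele n : FinAdele) = (n : FinAdele) := by
  simp [natIdele]

/-- This is the product formula for the rational number $n$. -/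
lemma finNorm_natIdele (n : ℕ) [NeZero n] : finNorm (natIdele n) = (n : ℝ)⁻¹ := by
  have h := FinitePlace.prod_eq_inv_abs_norm (K := ℚ) (x := n) (NeZero.ne _)
  rw [← finprod_comp_equiv FinitePlace.equivHeightOneSpectrum.symm] at h
  simp only [FinitePlace.equivHeightOneSpectrum_symm_apply] at h
  refine Eq.trans ?_ (h.trans ?_)
  · rfl
  -- The product formula uses another `ℚ`-algebra structure on `ℚ`; it is unique, so the norm is
  -- still the identity.
  · have hn : @Algebra.norm ℚ ℚ _ _ DivisionRing.toRatAlgebra (n : ℚ) = n := by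
      rw [Subsingleton.elim DivisionRing.toRatAlgebra (Algebra.id ℚ), Algebra.norm_self]
      rfl
    simp [hn]

lemma natMulZHatUnits_zero : natMulZHatUnits 0 = ∅ := by
  refine Set.eq_empty_of_forall_notMem fun x ⟨u, _, hx⟩ ↦ ?_
  obtain ⟨v⟩ : Nonempty (HeightOneSpectrum (𝓞 ℚ)) :=
    ⟨Rat.HeightOneSpectrum.primesEquiv.symm ⟨2, Nat.prime_two⟩⟩
  refine coe_ne_zero x v ?_
  rw [hx, Nat.cast_zero, zero_mul]
  rfl

lemma natMulZHatUnits_eq_smul (n : ℕ) [NeZero n] :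
    natMulZHatUnits n = natIdele n • zHatUnits := by
  ext x
  refine ⟨fun ⟨u, hu, hx⟩ ↦ ⟨u, hu, Units.ext ?_⟩, ?_⟩
  · simp [hx, coe_natIdele]
  · rintro ⟨u, hu, rfl⟩
    exact ⟨u, hu, by simp [coe_natIdele]⟩

lemma finNorm_of_mem {n : ℕ} {x : FinAdeleˣ} (hx : x ∈ natMulZHatUnits n) :
    finNorm x = (n : ℝ)⁻¹ := by
  rcases eq_or_ne n 0 with rfl | hn
  · simp [natMulZHatUnits_zero] at hx
  have := NeZero.mk hn
  rw [natMulZHatUnits_eq_smul] at hx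
  obtain ⟨u, hu, rfl⟩ := hx
  exact (finNorm_mul_of_mem_zHatUnits _ hu).trans (finNorm_natIdele n)

/-- The norm recovers $n$, so the choice made in `finFun` is no choice at all. -/
lemma eq_of_mem_natMulZHatUnits {m n : ℕ} {x : FinAdeleˣ} (hm : x ∈ natMulZHatUnits m)
    (hn : x ∈ natMulZHatUnits n) : m = n := by
  have h := (finNorm_of_mem hm).symm.trans (finNorm_of_mem hn)
  exact_mod_cast inv_injective h

lemma isOpen_natMulZHatUnits (n : ℕ) : IsOpen (natMulZHatUnits n) := by
  rcases eq_or_ne n 0 with rfl | hn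
  · simp [natMulZHatUnits_zero]
  have := NeZero.mk hn
  rw [natMulZHatUnits_eq_smul]
  exact isOpen_smul_zHatUnits _

lemma finMeasure_natMulZHatUnits {n : ℕ} (hn : n ≠ 0) : finMeasure (natMulZHatUnits n) = 1 := by
  have := NeZero.mk hn
  rw [natMulZHatUnits_eq_smul, finMeasure_smul_zHatUnits]

open Classical in
/-- The integer `n` on `n Ẑˣ`, and `0` off the union of these sets. -/
def finIndex (x : FinAdeleˣ) : ℕ :=
  if h : ∃ n : ℕ, x ∈ natMulZHatUnits n then h.choose else 0

lemma finIndex_of_mem {n : ℕ} {x : FinAdeleˣ} (hx : x ∈ natMulZHatUnits n) : finIndex x = n := by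
  have h : ∃ n : ℕ, x ∈ natMulZHatUnits n := ⟨n, hx⟩
  rw [finIndex, dif_pos h]
  exact eq_of_mem_natMulZHatUnits h.choose_spec hx

lemma finIndex_preimage {n : ℕ} (hn : n ≠ 0) : finIndex ⁻¹' {n} = natMulZHatUnits n := by
  ext x
  refine ⟨fun hx ↦ ?_, finIndex_of_mem⟩
  by_cases h : ∃ n : ℕ, x ∈ natMulZHatUnits n
  · obtain ⟨m, hm⟩ := h
    rwa [← hx, finIndex_of_mem hm]
  · exact absurd (by rw [← hx, finIndex, dif_neg h]) hn

lemma measurable_finIndex : Measurable finIndex := by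
  have h (n : ℕ) (hn : n ≠ 0) : MeasurableSet (finIndex ⁻¹' {n}) := by
    rw [finIndex_preimage hn]
    exact (isOpen_natMulZHatUnits n).measurableSet
  refine measurable_to_countable' fun n ↦ ?_
  rcases eq_or_ne n 0 with rfl | hn
  · have : finIndex ⁻¹' {0} = (⋃ n : ℕ, finIndex ⁻¹' {n + 1})ᶜ := by
      ext x
      simp only [Set.mem_preimage, Set.mem_singleton_iff, Set.mem_compl_iff, Set.mem_iUnion,
        not_exists]
      exact ⟨fun h n ↦ by omega, fun h ↦ by
        by_contra h0
        exact h (finIndex x - 1) (by omega)⟩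
    rw [this]
    exact (MeasurableSet.iUnion fun n ↦ h _ n.succ_ne_zero).compl
  · exact h n hn

/-- The default index 0 does no harm because the constant coefficient vanishes. -/
lemma finFun_eq (a : ℕ → ℂ) (h0 : a 0 = 0) (x : FinAdeleˣ) : finFun a x = a (finIndex x) := by
  unfold finFun finIndex
  split_ifs
  · rfl
  · exact h0.symm

lemma finNorm_eq_inv_finIndex {x : FinAdeleˣ} (hx : finIndex x ≠ 0) :
    finNorm x = (finIndex x : ℝ)⁻¹ :=
  finNorm_of_mem (by rw [← finIndex_preimage hx]; rfl)

lemma map_finIndex : (finMeasure.restrict (finIndex ⁻¹' {0}ᶜ)).map finIndex =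
    Measure.count.restrict {0}ᶜ := by
  refine Measure.ext_of_singleton fun n ↦ ?_
  rw [Measure.map_apply measurable_finIndex (measurableSet_singleton n),
    Measure.restrict_apply (measurable_finIndex (measurableSet_singleton n)),
    Measure.restrict_apply (measurableSet_singleton n), ← Set.preimage_inter]
  rcases eq_or_ne n 0 with rfl | hn
  · simp
  · have : ({n} ∩ {0}ᶜ : Set ℕ) = {n} := by simpa using hn.symm
    rw [this, finIndex_preimage hn, finMeasure_natMulZHatUnits hn, Measure.count_singleton]

end IdelicIteratedIntegral

/-! ### Two general facts on measures -/

lemma MeasureTheory.measurePreserving_prodProdProdComm {α β γ δ : Type*} [MeasurableSpace α]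
    [MeasurableSpace β] [MeasurableSpace γ] [MeasurableSpace δ] (μ : Measure α) (ν : Measure β)
    (ρ : Measure γ) (τ : Measure δ) [SFinite μ] [SFinite ν] [SFinite ρ] [SFinite τ] :
    MeasurePreserving (Equiv.prodProdProdComm α β γ δ) ((μ.prod ν).prod (ρ.prod τ))
      ((μ.prod ρ).prod (ν.prod τ)) := by
  have hm : Measurable (Equiv.prodProdProdComm α β γ δ) := by
    simp only [Equiv.prodProdProdComm, Equiv.coe_fn_mk]
    fun_prop
  refine ⟨hm, Measure.ext_of_lintegral _ fun f hf ↦ ?_⟩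
  rw [lintegral_map hf hm, lintegral_prod _ (by fun_prop), lintegral_prod _ (by fun_prop),
    lintegral_prod _ (by fun_prop), lintegral_prod _ (by fun_prop)]
  refine lintegral_congr fun a ↦ ?_
  calc
    _ = ∫⁻ b, ∫⁻ c, ∫⁻ d, f ((a, c), (b, d)) ∂τ ∂ρ ∂ν := by
      refine lintegral_congr fun b ↦ ?_
      rw [lintegral_prod _ (by fun_prop)]
      rfl
    _ = ∫⁻ c, ∫⁻ b, ∫⁻ d, f ((a, c), (b, d)) ∂τ ∂ν ∂ρ :=
      lintegral_lintegral_swap (by fun_prop)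
    _ = _ := by
      refine lintegral_congr fun c ↦ ?_
      rw [lintegral_prod _ (by fun_prop)]

lemma MeasureTheory.lintegral_eq_two_mul_of_even {f : ℝ → ENNReal} (hf : ∀ x, f (-x) = f x) :
    ∫⁻ x, f x = 2 * ∫⁻ x in Set.Ioi 0, f x := by
  have h : ∫⁻ x in Set.Iio 0, f x = ∫⁻ x in Set.Ioi 0, f x := by
    have := (Measure.measurePreserving_neg (volume : Measure ℝ)).setLIntegral_comp_preimage_emb
      (Homeomorph.neg ℝ).measurableEmbedding f (Set.Ioi 0)
    simpa [hf] using this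
  rw [← lintegral_add_compl f (measurableSet_Ioi (a := (0 : ℝ))), Set.compl_Ioi,
    setLIntegral_congr Iio_ae_eq_Iic.symm, h, two_mul]

namespace IdelicIteratedIntegral

/-! ### The distribution of the norm and the integer index on the ideles -/

/-- The measure `2 dt / t` on the positive real numbers. -/
def absMeasure : Measure ℝ :=
  (volume.restrict (Set.Ioi 0)).withDensity fun t ↦ ENNReal.ofReal (2 * t⁻¹)

instance : SigmaFinite absMeasure := SigmaFinite.withDensity_ofReal _

lemma map_val_realMeasure : realMeasure.map Units.val =
    volume.withDensity fun x : ℝ ↦ ENNReal.ofReal |x|⁻¹ := by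
  have hr : Set.range (Units.val : ℝˣ → ℝ) = {0}ᶜ := by
    ext x
    exact isUnit_iff_ne_zero
  have he : MeasurableEmbedding (Units.val : ℝˣ → ℝ) :=
    ⟨Units.val_injective, Units.continuous_val.measurable, fun {s} hs ↦ by
      have ho : IsOpen (Set.range (Units.val : ℝˣ → ℝ)) := by
        rw [hr]
        exact isOpen_compl_singleton
      exact (Units.isEmbedding_val₀.measurableEmbedding ho.measurableSet).measurableSet_image' hs⟩
  rw [realMeasure, he.map_comap, hr]
  -- The only real number that is not a unit is 0, a null set.
  refine Measure.restrict_eq_self_of_ae_mem ?_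
  exact compl_mem_ae_iff.mpr (by simp)

instance : SigmaFinite realMeasure := by
  refine SigmaFinite.of_map _ Units.continuous_val.measurable.aemeasurable ?_
  rw [map_val_realMeasure]
  infer_instance

/-- Scaling invariance of $dx/|x|$ removes $q$, and folding the line along $x \mapsto -x$ gives the
factor 2. That the result is independent of $q$ is what makes index and norm independent. -/
lemma map_abs_mul_realMeasure {q : ℝ} (hq : 0 < q) :
    realMeasure.map (fun y : ℝˣ ↦ |(y : ℝ)| * q) = absMeasure := by
  have hv : Measurable (Units.val : ℝˣ → ℝ) := Units.continuous_val.measurable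
  have hc : (fun y : ℝˣ ↦ |(y : ℝ)| * q) = (fun x : ℝ ↦ |x| * q) ∘ Units.val := rfl
  rw [hc, ← Measure.map_map (by fun_prop) hv, map_val_realMeasure]
  refine Measure.ext_of_lintegral _ fun f hf ↦ ?_
  rw [lintegral_map hf (by fun_prop), absMeasure,
    lintegral_withDensity_eq_lintegral_mul _ (by fun_prop) (by fun_prop),
    lintegral_withDensity_eq_lintegral_mul _ (by fun_prop) hf]
  set h : ℝ → ENNReal := fun x ↦ ENNReal.ofReal |x|⁻¹ * f |x| with hh
  have hm : Measurable h := by fun_prop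
  calc
    _ = ∫⁻ x, ENNReal.ofReal q * h (x * q) := by
      refine lintegral_congr fun x ↦ ?_
      simp only [hh, Pi.mul_apply, abs_mul, abs_of_pos hq]
      rw [← mul_assoc, ← ENNReal.ofReal_mul hq.le]
      congr 2
      field_simp
    _ = ENNReal.ofReal q * ∫⁻ x, h x ∂(volume.map (· * q)) := by
      rw [lintegral_const_mul _ (by fun_prop), lintegral_map hm (by fun_prop)]
    _ = ∫⁻ x, h x := by
      rw [Real.map_volume_mul_right hq.ne', lintegral_smul_measure, smul_eq_mul, ← mul_assoc,
        ← ENNReal.ofReal_mul hq.le, abs_of_pos (inv_pos.mpr hq), mul_inv_cancel₀ hq.ne',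
        ENNReal.ofReal_one, one_mul]
    _ = 2 * ∫⁻ x in Set.Ioi 0, h x := lintegral_eq_two_mul_of_even fun x ↦ by simp [hh]
    _ = _ := by
      rw [← lintegral_const_mul _ hm]
      refine setLIntegral_congr_fun measurableSet_Ioi fun x (hx : 0 < x) ↦ ?_
      simp only [hh, Pi.mul_apply, abs_of_pos hx]
      rw [ENNReal.ofReal_mul zero_le_two, ENNReal.ofReal_ofNat, mul_assoc]

lemma continuous_infPart : Continuous infPart := continuous_fst.comp ideleEquiv.symm.continuous

lemma continuous_finPart : Continuous finPart := continuous_snd.comp ideleEquiv.symm.continuous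

lemma continuous_ideleNorm : Continuous ideleNorm :=
  (Units.continuous_val.comp continuous_infPart).abs.mul
    (continuous_finNorm.comp continuous_finPart)

instance : SigmaFinite ideleMeasure :=
  measurableEmbedding_ideleEquiv.sigmaFinite_map

/-- The integer index of the finite part of an idele, together with its norm. -/
def indexNorm (x : Adeleˣ) : ℕ × ℝ := (finIndex (finPart x), ideleNorm x)

/-- The ideles whose finite part lies in `n Ẑˣ` for a positive integer `n`. -/
def indexSupport : Set Adeleˣ := {x | finIndex (finPart x) ≠ 0}

lemma measurableSet_indexSupport : MeasurableSet indexSupport :=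
  (measurable_finIndex.comp continuous_finPart.measurable) (measurableSet_singleton 0).compl

/-- The counting measure on the positive integers. -/
def posCount : Measure ℕ := Measure.count.restrict {0}ᶜ

instance : SigmaFinite posCount := inferInstanceAs (SigmaFinite (Measure.count.restrict _))

/-- Over each fixed finite part the norm has distribution $2\,dt/t$, so the joint distribution is a
product even though the norm involves the finite part. -/
lemma measurePreserving_indexNorm :
    MeasurePreserving indexNorm (ideleMeasure.restrict indexSupport)
      (posCount.prod absMeasure) := by
  have hm : Measurable indexNorm :=
    (measurable_finIndex.comp continuous_finPart.measurable).prodMk continuous_ideleNorm.measurable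
  refine ⟨hm, ?_⟩
  have hfin : MeasurePreserving finIndex (finMeasure.restrict (finIndex ⁻¹' {0}ᶜ)) posCount :=
    ⟨measurable_finIndex, map_finIndex⟩
  have hskew := hfin.skew_product (g := fun x (y : ℝˣ) ↦ |(y : ℝ)| * finNorm x) (μc := realMeasure)
    (μd := absMeasure)
    (((Units.continuous_val.measurable.comp measurable_snd).abs).mul
      (continuous_finNorm.measurable.comp measurable_fst)) (by
        refine (ae_restrict_mem (measurable_finIndex
          (measurableSet_singleton 0).compl)).mono fun x hx ↦ map_abs_mul_realMeasure ?_
        rw [finNorm_eq_inv_finIndex hx]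
        exact inv_pos.mpr (Nat.cast_pos.mpr (Nat.pos_of_ne_zero hx)))
  -- The skew product has the finite factor first, `ideleEquiv` the real one.
  have h := hskew.comp Measure.measurePreserving_swap
  have hs : ideleEquiv ⁻¹' indexSupport = Set.univ ×ˢ (finIndex ⁻¹' {0}ᶜ) := by
    ext p
    simp [indexSupport, finPart]
  rw [ideleMeasure, measurableEmbedding_ideleEquiv.restrict_map,
    Measure.map_map hm measurableEmbedding_ideleEquiv.measurable, hs, ← Measure.prod_restrict,
    Measure.restrict_univ, ← h.map_eq]
  congr 1
  ext p <;> simp [indexNorm, finPart, infPart, ideleNorm]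

/-- The term `a n e^{-2π n t} t^s` at `(n, t)`. -/
def coeffTerm (a : ℕ → ℂ) (s : ℂ) (p : ℕ × ℝ) : ℂ :=
  a p.1 * Real.exp (-2 * Real.pi * (p.1 * p.2)) * (p.2 : ℂ) ^ s

lemma measurable_coeffTerm (a : ℕ → ℂ) (s : ℂ) : Measurable (coeffTerm a s) := by
  unfold coeffTerm
  fun_prop

lemma ideleFun_mul_cpow {a : ℕ → ℂ} (h0 : a 0 = 0) (s : ℂ) (x : Adeleˣ) :
    ideleFun a x * (ideleNorm x : ℂ) ^ s = coeffTerm a s (indexNorm x) := by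
  rw [ideleFun, finFun_eq a h0, coeffTerm, indexNorm]
  by_cases hx : finIndex (finPart x) = 0
  · simp [hx, h0]
  · have : (finIndex (finPart x) : ℝ) * ideleNorm x = |(infPart x : ℝ)| := by
      have hn : (finIndex (finPart x) : ℝ) ≠ 0 := Nat.cast_ne_zero.mpr hx
      rw [ideleNorm, finNorm_eq_inv_finIndex hx]
      field_simp
    rw [this]

/-- The pairs with `t₁ > t₂`. -/
def indexDomain : Set ((ℕ × ℝ) × (ℕ × ℝ)) := {p | p.2.2 < p.1.2}

lemma measurableSet_indexDomain : MeasurableSet indexDomain :=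
  measurableSet_lt (by fun_prop) (by fun_prop)

/-- The integrand of `J` in terms of the integer indices and the norms. -/
def indexIntegrand (a b : ℕ → ℂ) (s₁ s₂ : ℂ) (p : (ℕ × ℝ) × (ℕ × ℝ)) : ℂ :=
  coeffTerm a s₁ p.1 * coeffTerm b s₂ p.2

lemma measurable_indexIntegrand (a b : ℕ → ℂ) (s₁ s₂ : ℂ) :
    Measurable (indexIntegrand a b s₁ s₂) :=
  ((measurable_coeffTerm a s₁).comp measurable_fst).mul
    ((measurable_coeffTerm b s₂).comp measurable_snd)

lemma ideleIntegrand_eq {a b : ℕ → ℂ} (ha : a 0 = 0) (hb : b 0 = 0) (s₁ s₂ : ℂ) :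
    ideleIntegrand a b s₁ s₂ = indexIntegrand a b s₁ s₂ ∘ Prod.map indexNorm indexNorm := by
  ext x
  rw [ideleIntegrand, ideleFun_mul_cpow ha, ideleFun_mul_cpow hb]
  rfl

lemma ideleIntegrand_eq_zero {a b : ℕ → ℂ} (ha : a 0 = 0) (hb : b 0 = 0) (s₁ s₂ : ℂ)
    {x : Adeleˣ × Adeleˣ} (hx : x ∉ indexSupport ×ˢ indexSupport) :
    ideleIntegrand a b s₁ s₂ x = 0 := by
  rw [ideleIntegrand_eq ha hb]
  simp only [Set.mem_prod, indexSupport, Set.mem_ofPred_eq, not_and_or, not_not] at hx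
  rcases hx with hx | hx <;> simp [indexIntegrand, coeffTerm, indexNorm, hx, ha, hb]

lemma measurePreserving_indexNorm_prod :
    MeasurePreserving (Prod.map indexNorm indexNorm)
      (((ideleMeasure.prod ideleMeasure).restrict ideleDomain).restrict
        (indexSupport ×ˢ indexSupport))
      (((posCount.prod absMeasure).prod (posCount.prod absMeasure)).restrict indexDomain) := by
  have h := (measurePreserving_indexNorm.prod measurePreserving_indexNorm).restrict_preimage
    measurableSet_indexDomain
  rwa [Measure.prod_restrict, ← Measure.restrict_comm
    (measurableSet_indexSupport.prod measurableSet_indexSupport)] at h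

/-- The integrand vanishes off the support, and on it integrability passes along the
measure-preserving map. -/
lemma jConverges_iff {a b : ℕ → ℂ} (ha : a 0 = 0) (hb : b 0 = 0) (s₁ s₂ : ℂ) :
    JConverges a b s₁ s₂ ↔ IntegrableOn (indexIntegrand a b s₁ s₂) indexDomain
      ((posCount.prod absMeasure).prod (posCount.prod absMeasure)) := by
  rw [JConverges, IntegrableOn, ← integrableOn_iff_integrable_of_support_subset
    (s := indexSupport ×ˢ indexSupport), IntegrableOn, ideleIntegrand_eq ha hb,
    measurePreserving_indexNorm_prod.integrable_comp
      (measurable_indexIntegrand a b s₁ s₂).aestronglyMeasurable, IntegrableOn]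
  exact fun x hx ↦ by_contra fun h ↦ hx (ideleIntegrand_eq_zero ha hb s₁ s₂ h)

lemma j_eq {a b : ℕ → ℂ} (ha : a 0 = 0) (hb : b 0 = 0) (s₁ s₂ : ℂ) :
    J a b s₁ s₂ = ∫ p in indexDomain, indexIntegrand a b s₁ s₂ p
    ∂((posCount.prod absMeasure).prod (posCount.prod absMeasure)) := by
  rw [J, ← setIntegral_eq_integral_of_forall_compl_eq_zero
    (fun x hx ↦ ideleIntegrand_eq_zero ha hb s₁ s₂ hx), ideleIntegrand_eq ha hb,
    ← measurePreserving_indexNorm_prod.map_eq, integral_map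
      measurePreserving_indexNorm_prod.measurable.aemeasurable
      (measurable_indexIntegrand a b s₁ s₂).aestronglyMeasurable]
  rfl

/-! ### Cusp forms on the imaginary axis -/

section CuspForm

variable {k : ℤ} (F : CuspForm 𝒮ℒ k)

/-- There are no forms of negative weight; those of weight 0 are constants, and vanishing at the
cusp kills them. -/
lemma cuspForm_eq_zero_of_nonpos (hk : k ≤ 0) : ⇑F = 0 := by
  rcases hk.lt_or_eq with hk | rfl
  · exact ModularFormClass.levelOne_neg_weight_eq_zero hk F
  · obtain ⟨c, hc⟩ := ModularFormClass.levelOne_weight_zero_const F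
    have h := CuspFormClass.zero_at_infty F
    rw [hc] at h
    have hc0 : c = 0 := tendsto_nhds_unique tendsto_const_nhds h
    rw [hc, hc0]
    rfl

lemma fourierCoeff_zero : fourierCoeff F 0 = 0 :=
  CuspFormClass.qExpansion_coeff_zero F one_pos one_mem_strictPeriods_SL

lemma integrableOn_cuspForm_mul_cpow_div (s : ℂ) :
    IntegrableOn (fun t : ℝ ↦ F (ofComplex (Complex.I * t)) * (t : ℂ) ^ s / t) (Set.Ioi 0) := by
  rcases le_or_gt k 0 with hk | hk
  · simp [cuspForm_eq_zero_of_nonpos F hk]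
  · have hP := CuspForm.isStrongFEPair hk F
    have h : MellinConvergent (ModularForm.weakFEPair hk F).f s :=
      mellinConvergent_of_isBigO_rpow (ModularForm.weakFEPair hk F).hf_int
        -- The decay at both ends beats every power, so any exponents on either side of
        -- $\operatorname{Re}s$ serve.
        (a := s.re + 1) (b := s.re - 1) (hP.hf_top _) (by linarith) (hP.hf_zero _) (by linarith)
    refine h.congr_fun (fun t (ht : 0 < t) ↦ ?_) measurableSet_Ioi
    have ht' : (t : ℂ) ≠ 0 := Complex.ofReal_ne_zero.mpr ht.ne'
    simp only [ModularForm.weakFEPair_f, smul_eq_mul, Complex.cpow_sub _ _ ht', Complex.cpow_one]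
    ring

lemma hasSum_coeffTerm_fourierCoeff (s : ℂ) {t : ℝ} (ht : 0 < t) :
    HasSum (fun n ↦ coeffTerm (fourierCoeff F) s (n, t))
      (F (ofComplex (Complex.I * t)) * (t : ℂ) ^ s) := by
  suffices h : HasSum (fun n ↦ fourierCoeff F n * (Real.exp (-2 * Real.pi * (n * t)) : ℂ))
      (F (ofComplex (Complex.I * t))) by
    simpa only [coeffTerm] using h.mul_right ((t : ℂ) ^ s)
  convert! ModularForm.hasSum_qExpansion F one_pos one_mem_strictPeriods_SL
    (ofComplex (Complex.I * t)) using 2 with n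
  have hτ : ((ofComplex (Complex.I * t) : ℍ) : ℂ) = Complex.I * t := by
    simp [ofComplex_apply_of_im_pos, ht]
  rw [hτ, Function.Periodic.qParam, ← Complex.exp_nat_mul, Complex.ofReal_exp]
  congr 2
  push_cast
  linear_combination (-2 * Real.pi * n * t : ℂ) * Complex.I_sq

lemma integral_coeffTerm_fourierCoeff (s : ℂ) {t : ℝ} (ht : 0 < t) :
    ∫ n, coeffTerm (fourierCoeff F) s (n, t) ∂posCount =
      F (ofComplex (Complex.I * t)) * (t : ℂ) ^ s := by
  have h := hasSum_coeffTerm_fourierCoeff F s ht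
  rw [posCount, setIntegral_eq_integral_of_forall_compl_eq_zero, integral_countable]
  · simpa [Measure.real] using h.tsum_eq
  · exact integrable_count_iff.mpr h.summable.norm
  · intro n hn
    obtain rfl : n = 0 := by simpa using hn
    simp [coeffTerm, fourierCoeff_zero]

/-- Hecke's bound, with cusp width 1. -/
lemma fourierCoeff_isBigO :
    fourierCoeff F =O[Filter.atTop] fun n ↦ (n : ℝ) ^ ((k : ℝ) / 2) := by
  have h := CuspFormClass.qExpansion_isBigO F
  rwa [Subgroup.strictWidthInfty_SL2Z] at h

end CuspForm

lemma norm_coeffTerm (a : ℕ → ℂ) (s : ℂ) (n : ℕ) {t : ℝ} (ht : 0 < t) :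
    ‖coeffTerm a s (n, t)‖ = ‖a n‖ * Real.exp (-(2 * Real.pi * n * t)) * t ^ s.re := by
  rw [coeffTerm, norm_mul, norm_mul, Complex.norm_cpow_eq_rpow_re_of_pos ht, Complex.norm_real,
    Real.norm_of_nonneg (Real.exp_nonneg _)]
  ring_nf

lemma integrable_absMeasure_iff {f : ℝ → ℂ} : Integrable f absMeasure ↔
    IntegrableOn (fun t ↦ (2 * t⁻¹ : ℝ) • f t) (Set.Ioi 0) := by
  rw [absMeasure, integrable_withDensity_iff_integrable_smul' (by fun_prop)
    (.of_forall fun _ ↦ ENNReal.ofReal_lt_top), IntegrableOn]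
  refine integrable_congr ((ae_restrict_mem measurableSet_Ioi).mono fun t (ht : 0 < t) ↦ ?_)
  simp only
  rw [ENNReal.toReal_ofReal (by positivity)]

lemma integral_absMeasure (f : ℝ → ℝ) : ∫ t, f t ∂absMeasure =
    ∫ t in Set.Ioi 0, (2 * t⁻¹) * f t := by
  rw [absMeasure, integral_withDensity_eq_integral_toReal_smul (by fun_prop)
    (.of_forall fun _ ↦ ENNReal.ofReal_lt_top)]
  refine setIntegral_congr_fun measurableSet_Ioi fun t (ht : 0 < t) ↦ ?_
  rw [ENNReal.toReal_ofReal (by positivity), smul_eq_mul]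

lemma inv_mul_norm_coeffTerm (a : ℕ → ℂ) (s : ℂ) (n : ℕ) {t : ℝ} (ht : 0 < t) :
    2 * t⁻¹ * ‖coeffTerm a s (n, t)‖ =
      2 * ‖a n‖ * (t ^ (s.re - 1) * Real.exp (-(2 * Real.pi * n * t))) := by
  rw [norm_coeffTerm a s n ht, Real.rpow_sub_one ht.ne']
  ring

/-- By Tonelli the integral of the norm is $2(2\pi)^{-\sigma}\Gamma(\sigma)\sum|a_n|n^{-\sigma}$
with $\sigma = \operatorname{Re}s$. The Gamma integral needs $\sigma > 0$, the series $r - \sigma <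
-1$. -/
lemma integrable_coeffTerm {a : ℕ → ℂ} {r : ℝ} (ha : a =O[Filter.atTop] fun n ↦ (n : ℝ) ^ r)
    {s : ℂ} (hs : 0 < s.re) (hrs : r + 1 < s.re) :
    Integrable (coeffTerm a s) (posCount.prod absMeasure) := by
  have hne : ∀ᵐ n ∂posCount, 0 < n :=
    (ae_restrict_mem (measurableSet_singleton 0).compl).mono fun n hn ↦ Nat.pos_of_ne_zero hn
  refine (integrable_prod_iff (measurable_coeffTerm a s).aestronglyMeasurable).mpr
    ⟨hne.mono fun n hn ↦ ?_, ?_⟩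
  · have hn' : (0 : ℝ) < 2 * Real.pi * n := by positivity
    have h := integrableOn_rpow_mul_exp_neg_mul_rpow (p := 1) (s := s.re - 1) (by linarith) one_pos
      hn'
    rw [integrable_absMeasure_iff, IntegrableOn]
    have hm : Measurable fun t : ℝ ↦ (2 * t⁻¹ : ℝ) • coeffTerm a s (n, t) :=
      (by fun_prop : Measurable fun t : ℝ ↦ (2 * t⁻¹ : ℝ)).smul
        ((measurable_coeffTerm a s).comp measurable_prodMk_left)
    refine (h.const_mul (2 * ‖a n‖)).mono' hm.aestronglyMeasurable
      ((ae_restrict_mem measurableSet_Ioi).mono fun t (ht : 0 < t) ↦ ?_)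
    rw [norm_smul, Real.norm_of_nonneg (by positivity), inv_mul_norm_coeffTerm a s n ht]
    simp
  · have hsum : Summable fun n : ℕ ↦ ‖a n‖ * (n : ℝ) ^ (-s.re) := by
      refine summable_of_isBigO_nat (Real.summable_nat_rpow.mpr (by linarith : r - s.re < -1)) ?_
      refine (ha.norm_left.mul (Asymptotics.isBigO_refl _ _)).trans_eventuallyEq ?_
      filter_upwards [Filter.eventually_gt_atTop 0] with n hn
      rw [← Real.rpow_add (Nat.cast_pos.mpr hn), sub_eq_add_neg]
    have hsum' := hsum.mul_left (2 * (2 * Real.pi) ^ (-s.re) * Real.Gamma s.re)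
    have hint : Integrable _ posCount := (integrable_count_iff.mpr hsum'.norm).integrableOn
    refine hint.congr (hne.mono fun n hn ↦ ?_)
    have hn' : (0 : ℝ) < 2 * Real.pi * n := by positivity
    simp only
    rw [integral_absMeasure, setIntegral_congr_fun measurableSet_Ioi
      fun t ht ↦ inv_mul_norm_coeffTerm a s n ht, integral_const_mul,
      Real.integral_rpow_mul_exp_neg_mul_Ioi hs hn', one_div, Real.inv_rpow hn'.le,
      ← Real.rpow_neg hn'.le,
      Real.mul_rpow (x := 2 * Real.pi) (y := n) (by positivity) (by positivity)]
    ring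

lemma integrable_coeffTerm_fourierCoeff {k : ℤ} (F : CuspForm 𝒮ℒ k) {s : ℂ}
    (hs : (k : ℝ) / 2 + 1 < s.re) :
    Integrable (coeffTerm (fourierCoeff F) s) (posCount.prod absMeasure) := by
  -- For negative weight the hypothesis need not give $\operatorname{Re}s > 0$, but then $F = 0$.
  rcases lt_or_ge k 0 with hk | hk
  · have h0 : coeffTerm (fourierCoeff F) s = 0 := by
      ext p
      simp [coeffTerm, fourierCoeff, cuspForm_eq_zero_of_nonpos F hk.le, qExpansion_zero]
    rw [h0]
    exact integrable_zero _ _ _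
  · have hk' : (0 : ℝ) ≤ k := Int.cast_nonneg hk
    exact integrable_coeffTerm (fourierCoeff_isBigO F) (by linarith) hs

/-! ### Comparison of the two integrals -/

lemma realIntegrand_eq_mul (F G : ℍ → ℂ) (s₁ s₂ : ℂ) (t : ℝ × ℝ) :
    realIntegrand F G s₁ s₂ t = F (ofComplex (Complex.I * t.1)) * (t.1 : ℂ) ^ s₁ / t.1 *
      (G (ofComplex (Complex.I * t.2)) * (t.2 : ℂ) ^ s₂ / t.2) := by
  rw [realIntegrand, div_mul_div_comm]

lemma realDomain_eq :
    realDomain = {t : ℝ × ℝ | t.2 < t.1} ∩ Set.Ioi 0 ×ˢ Set.Ioi 0 := by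
  ext t
  simp only [realDomain, Set.mem_ofPred_eq, Set.mem_inter_iff, Set.mem_prod, Set.mem_Ioi]
  exact ⟨fun h ↦ ⟨h.1, h.2.trans h.1, h.2⟩, fun h ↦ ⟨h.1, h.2.2⟩⟩

lemma measurableSet_snd_lt_fst : MeasurableSet {t : ℝ × ℝ | t.2 < t.1} :=
  measurableSet_lt measurable_snd measurable_fst

lemma measurableSet_realDomain : MeasurableSet realDomain := by
  rw [realDomain_eq]
  exact measurableSet_snd_lt_fst.inter (measurableSet_Ioi.prod measurableSet_Ioi)

lemma lambdaConverges {k l : ℤ} (F : CuspForm 𝒮ℒ k) (G : CuspForm 𝒮ℒ l) (s₁ s₂ : ℂ) :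
    LambdaConverges F G s₁ s₂ := by
  have h := (integrableOn_cuspForm_mul_cpow_div F s₁).mul_prod
    (integrableOn_cuspForm_mul_cpow_div G s₂)
  rw [Measure.prod_restrict] at h
  refine IntegrableOn.mono_set (t := Set.Ioi 0 ×ˢ Set.Ioi 0) ?_
    (realDomain_eq ▸ Set.inter_subset_right)
  simp only [← realIntegrand_eq_mul] at h
  exact h

lemma absMeasure_prod_restrict :
    (absMeasure.prod absMeasure).restrict {t : ℝ × ℝ | t.2 < t.1} =
      (volume.restrict realDomain).withDensity
        fun t ↦ ENNReal.ofReal (2 * t.1⁻¹) * ENNReal.ofReal (2 * t.2⁻¹) := by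
  rw [absMeasure, prod_withDensity (by fun_prop) (by fun_prop),
    restrict_withDensity measurableSet_snd_lt_fst, Measure.prod_restrict,
    Measure.restrict_restrict measurableSet_snd_lt_fst, ← realDomain_eq]
  rfl

lemma integral_absMeasure_prod (f : ℝ × ℝ → ℂ) :
    ∫ t in {t : ℝ × ℝ | t.2 < t.1}, f t ∂(absMeasure.prod absMeasure) =
      4 * ∫ t in realDomain, f t / (t.1 * t.2) := by
  rw [absMeasure_prod_restrict, integral_withDensity_eq_integral_toReal_smul (by fun_prop)
    (.of_forall fun _ ↦ ENNReal.mul_lt_top ENNReal.ofReal_lt_top ENNReal.ofReal_lt_top),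
    ← integral_const_mul]
  refine setIntegral_congr_fun measurableSet_realDomain fun t ⟨h, h₂⟩ ↦ ?_
  have h₁ : 0 < t.1 := h₂.trans h
  rw [ENNReal.toReal_mul, ENNReal.toReal_ofReal (by positivity),
    ENNReal.toReal_ofReal (by positivity), Complex.real_smul]
  push_cast
  field_simp
  ring

/-- The domain restricts only the norms. With the indices grouped together, absolute convergence
permits summing first, and at fixed $(t_1,t_2)$ the double sum factors. -/
lemma setIntegral_indexIntegrand {a b : ℕ → ℂ} {s₁ s₂ : ℂ}
    (h : IntegrableOn (indexIntegrand a b s₁ s₂) indexDomain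
      ((posCount.prod absMeasure).prod (posCount.prod absMeasure))) :
    ∫ p in indexDomain, indexIntegrand a b s₁ s₂ p
        ∂((posCount.prod absMeasure).prod (posCount.prod absMeasure)) =
      ∫ t in {t : ℝ × ℝ | t.2 < t.1}, (∫ n, coeffTerm a s₁ (n, t.1) ∂posCount) *
        (∫ n, coeffTerm b s₂ (n, t.2) ∂posCount) ∂(absMeasure.prod absMeasure) := by
  have hD : indexDomain =
      Equiv.prodProdProdComm ℕ ℝ ℕ ℝ ⁻¹' (Set.univ ×ˢ {t : ℝ × ℝ | t.2 < t.1}) := by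
    ext p
    simp [indexDomain]
  set H : (ℕ × ℕ) × (ℝ × ℝ) → ℂ :=
    fun p ↦ coeffTerm a s₁ (p.1.1, p.2.1) * coeffTerm b s₂ (p.1.2, p.2.2)
  have hH : Measurable H :=
    ((measurable_coeffTerm a s₁).comp (by fun_prop)).mul
      ((measurable_coeffTerm b s₂).comp (by fun_prop))
  have he := (measurePreserving_prodProdProdComm posCount absMeasure posCount
    absMeasure).restrict_preimage (MeasurableSet.univ.prod measurableSet_snd_lt_fst)
  rw [← hD, ← Measure.prod_restrict, Measure.restrict_univ] at he
  have hint : Integrable H _ := (he.integrable_comp hH.aestronglyMeasurable).mp h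
  calc
    _ = ∫ p, H p ∂((posCount.prod posCount).prod
        ((absMeasure.prod absMeasure).restrict {t : ℝ × ℝ | t.2 < t.1})) := by
      rw [← he.map_eq, integral_map he.measurable.aemeasurable hH.aestronglyMeasurable]
      rfl
    _ = _ := by
      rw [integral_prod_symm _ hint]
      exact integral_congr_ae (.of_forall fun t ↦ integral_prod_mul
        (fun n ↦ coeffTerm a s₁ (n, t.1)) (fun n ↦ coeffTerm b s₂ (n, t.2)))

end IdelicIteratedIntegral

end

theorem theorem6p1 {k l : ℤ} (hk : Even k) (hl : Even l) (F : CuspForm 𝒮ℒ k) (G : CuspForm 𝒮ℒ l)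
    (s₁ s₂ : ℂ) :
    IdelicIteratedIntegral.LambdaConverges F G s₁ s₂ ∧
    ((k : ℝ) / 2 + 1 < s₁.re → (l : ℝ) / 2 + 1 < s₂.re →
      IdelicIteratedIntegral.JConverges (IdelicIteratedIntegral.fourierCoeff F)
        (IdelicIteratedIntegral.fourierCoeff G) s₁ s₂) ∧
    (IdelicIteratedIntegral.JConverges (IdelicIteratedIntegral.fourierCoeff F)
        (IdelicIteratedIntegral.fourierCoeff G) s₁ s₂ →
      IdelicIteratedIntegral.J (IdelicIteratedIntegral.fourierCoeff F)
        (IdelicIteratedIntegral.fourierCoeff G) s₁ s₂ =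
      4 * IdelicIteratedIntegral.Lambda F G s₁ s₂) := by
  open IdelicIteratedIntegral in
  have hF := fourierCoeff_zero F
  have hG := fourierCoeff_zero G
  refine ⟨lambdaConverges F G s₁ s₂, fun h₁ h₂ ↦ ?_, fun h ↦ ?_⟩
  · exact (jConverges_iff hF hG s₁ s₂).mpr ((integrable_coeffTerm_fourierCoeff F h₁).mul_prod
      (integrable_coeffTerm_fourierCoeff G h₂)).integrableOn
  · rw [j_eq hF hG, setIntegral_indexIntegrand ((jConverges_iff hF hG s₁ s₂).mp h),
      integral_absMeasure_prod, Lambda]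
    congr 1
    refine setIntegral_congr_fun measurableSet_realDomain fun t ⟨ht, ht₂⟩ ↦ ?_
    rw [integral_coeffTerm_fourierCoeff F s₁ (ht₂.trans ht),
      integral_coeffTerm_fourierCoeff G s₂ ht₂, realIntegrand]
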